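/- For a finite graph $G$, the burning number $b(G)$ is the smallest integer $k$ such that the vertices of $G$ can be covered by $k$ balls (in the graph distance, centred at vertices) of radii $0,1,\dots,k-1$, one of each radius. Then $b(G)\le(1+o(1))\sqrt n$ for all connected graphs $G$ on $n$ vertices, uniformly in $G$ as $n\to\infty$. That is, for every $\varepsilon>0$ there is an $N$ such that every finite connected simple graph $G$ on $n\ge N$ vertices satisfies $b(G)\le(1+\varepsilon)\sqrt n$. -/

import Mathlib

namespace SimpleGraph

variable {V : Type*}

/-- `G` can be burned in `k` turns: the balls (for the graph distance) of radii `0, …, k - 1`, one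
of each radius, around suitable vertices cover all vertices of `G`. The extended distance makes a
ball stay inside the component of its centre. -/
def CanBurn (G : SimpleGraph V) (k : ℕ) : Prop :=
  ∃ c : Fin k → V, ∀ v : V, ∃ i : Fin k, G.edist (c i) v ≤ (i : ℕ)

/-- The burning number of a graph: the smallest `k` such that the vertices can be covered by
balls of radii `0, …, k - 1`. -/
noncomputable def burningNumber (G : SimpleGraph V) : ℕ :=
  sInf {k : ℕ | G.CanBurn k}

/-- A finite graph can always be burned, so the infimum above is over a nonempty set. -/
theorem exists_canBurn [Finite V] (G : SimpleGraph V) : ∃ k, G.CanBurn k := by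
  obtain ⟨n, ⟨e⟩⟩ := Finite.exists_equiv_fin V
  exact ⟨n, e.symm, fun v => ⟨e v, by simp⟩⟩

/-- The burning number of a finite graph is attained. -/
theorem canBurn_burningNumber [Finite V] (G : SimpleGraph V) : G.CanBurn G.burningNumber :=
  Nat.sInf_mem G.exists_canBurn

end SimpleGraph

/-!
A breadth-first search tree turns the problem into one about a finite rooted tree with its path
metric, where every set of diameter `z` lies in a ball of radius `⌈z / 2⌉`
(`ParentTree.exists_center`).

The heart of the argument is a statement about prices. Let `s z`, nondecreasing in `z`, be the price
of a set of diameter at most `z`, and call a tree irreducible if no descending part `D` of it has a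
cover by sets of total price less than `|D|`. Then `∑ z < R, s z ≥ R ^ 2 / 2` as soon as the
irreducible tree has diameter at least `R` (`ParentTree.Irreducible.sq_le`). To see this for the
least failing `R`, take a deepest subtree of diameter at least `R`, of diameter `d = R + g`, say. By
the four point condition, the vertices within `z` of one end of a diametral path, those within
`d - 1 - z` of the other end, and the subtrees just outside form a cover, for every `z`. Summing the
inequalities that irreducibility gives for these covers counts each `s z` about twice and each
vertex that hangs off the path about once per end. The subtrees at `e` hanging vertices cost at most
`∑ z < e, s z` (`ParentTree.sum_diam_le`), and convexity of the partial sums does the rest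
(`partialSum.not_lt_sq`).

The prices come from the multiplicative weights method. The radii below `J * m` form `J` classes of
`m` radii each, the `j`-th consisting of radii at least `j * m`. A class of which `u` balls have
been used has weight `(1 + η / m) ^ u`, and `s z` is proportional to the least weight of a class
that can cover sets of diameter `z`. With the right proportionality factor
`∑ z < R, s z < R ^ 2 / 2` for `R = 2 * (J - 1) * m`, so that a part `D` of the tree can be cut off
cheaply
(`ParentTree.exists_cheap_cover`), until one ball of radius `J * m` covers what is left
(`ParentTree.exists_cover`). Each cut multiplies the sum of the weights by at most
`exp (η' * |D| / ((J - 1) ^ 2 * m ^ 2))`, where `η'` is close to `η`. Hence no class is used more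
than `m` times if `J` and `m` are large and `J * m` is about `(1 + ε / 2) * √|V|`.
-/

/-! ### Rooted trees -/

/-- A rooted tree on `V`, given by the parent and the depth of every vertex. The root is the only
vertex of depth `0`, and it is its own parent. -/
structure ParentTree (V : Type*) where
  root : V
  par : V → V
  dep : V → ℕ
  dep_root : dep root = 0
  eq_root : ∀ x, dep x = 0 → x = root
  dep_par : ∀ x, dep (par x) = dep x - 1

namespace ParentTree

variable {V : Type*} (P : ParentTree V)

/-- The ancestor of `x` at depth `d`; it is `x` itself if `d` exceeds the depth of `x`. -/
def anc (x : V) (d : ℕ) : V := P.par^[P.dep x - d] x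

theorem dep_iterate (x : V) (k : ℕ) : P.dep (P.par^[k] x) = P.dep x - k := by
  induction k with
  | zero => simp
  | succ k ih => rw [Function.iterate_succ_apply', P.dep_par, ih]; omega

theorem dep_anc {x : V} {d : ℕ} (h : d ≤ P.dep x) : P.dep (P.anc x d) = d := by
  rw [anc, dep_iterate]; omega

theorem anc_anc {x : V} {d e : ℕ} (h : d ≤ P.dep x) (he : e ≤ d) :
    P.anc (P.anc x d) e = P.anc x e := by
  have h1 : P.anc (P.anc x d) e = P.par^[d - e] (P.anc x d) := by
    rw [anc, P.dep_anc h]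
  rw [h1, anc, anc, ← Function.iterate_add_apply]
  congr 1
  omega

@[simp] theorem anc_dep (x : V) : P.anc x (P.dep x) = x := by simp [anc]

@[simp] theorem anc_zero (x : V) : P.anc x 0 = P.root :=
  P.eq_root _ (P.dep_anc (Nat.zero_le _))

theorem anc_pred {x : V} (h : P.dep x ≠ 0) : P.anc x (P.dep x - 1) = P.par x := by
  have : P.dep x - (P.dep x - 1) = 1 := by omega
  rw [anc, this, Function.iterate_one]

open Classical in
/-- The depth of the last common ancestor of `x` and `y`. -/
noncomputable def meetDepth (x y : V) : ℕ :=
  Nat.findGreatest (fun d => P.anc x d = P.anc y d) (min (P.dep x) (P.dep y))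

theorem le_meetDepth {x y : V} {e : ℕ} :
    e ≤ P.meetDepth x y ↔ e ≤ P.dep x ∧ e ≤ P.dep y ∧ P.anc x e = P.anc y e := by
  classical
  have hle : P.meetDepth x y ≤ min (P.dep x) (P.dep y) := Nat.findGreatest_le _
  have hs : P.anc x (P.meetDepth x y) = P.anc y (P.meetDepth x y) :=
    Nat.findGreatest_spec (P := fun d => P.anc x d = P.anc y d) (m := 0) (Nat.zero_le _) (by simp)
  constructor
  · intro h
    have h1 : P.meetDepth x y ≤ P.dep x := by omega
    have h2 : P.meetDepth x y ≤ P.dep y := by omega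
    refine ⟨by omega, by omega, ?_⟩
    rw [← P.anc_anc h1 h, ← P.anc_anc h2 h, hs]
  · rintro ⟨h1, h2, h3⟩
    exact Nat.le_findGreatest (le_min h1 h2) h3

theorem meetDepth_le_left (x y : V) : P.meetDepth x y ≤ P.dep x := (P.le_meetDepth.1 le_rfl).1

theorem meetDepth_le_right (x y : V) : P.meetDepth x y ≤ P.dep y := (P.le_meetDepth.1 le_rfl).2.1

theorem anc_meetDepth (x y : V) :
    P.anc x (P.meetDepth x y) = P.anc y (P.meetDepth x y) := (P.le_meetDepth.1 le_rfl).2.2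

theorem meetDepth_comm (x y : V) : P.meetDepth x y = P.meetDepth y x :=
  eq_of_forall_le_iff fun e => by
    rw [P.le_meetDepth, P.le_meetDepth]
    constructor <;> rintro ⟨h1, h2, h3⟩ <;> exact ⟨h2, h1, h3.symm⟩

@[simp] theorem meetDepth_self (x : V) : P.meetDepth x x = P.dep x :=
  le_antisymm (P.meetDepth_le_left x x) (P.le_meetDepth.2 ⟨le_rfl, le_rfl, rfl⟩)

theorem meetDepth_anc {x : V} {d : ℕ} (h : d ≤ P.dep x) (y : V) :
    P.meetDepth (P.anc x d) y = min (P.meetDepth x y) d :=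
  eq_of_forall_le_iff fun e => by
    rw [le_min_iff, P.le_meetDepth, P.le_meetDepth, P.dep_anc h]
    constructor
    · rintro ⟨h1, h2, h3⟩
      rw [P.anc_anc h h1] at h3
      exact ⟨⟨by omega, h2, h3⟩, h1⟩
    · rintro ⟨⟨h1, h2, h3⟩, h4⟩
      exact ⟨h4, h2, by rw [P.anc_anc h h4, h3]⟩

theorem meetDepth_par {x : V} (h : P.dep x ≠ 0) (y : V) :
    P.meetDepth (P.par x) y = min (P.meetDepth x y) (P.dep x - 1) := by
  rw [← P.anc_pred h, P.meetDepth_anc (by omega)]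

theorem min_meetDepth_le (x y z : V) :
    min (P.meetDepth x y) (P.meetDepth y z) ≤ P.meetDepth x z := by
  set e := min (P.meetDepth x y) (P.meetDepth y z) with he
  obtain ⟨h1, h2, h3⟩ := P.le_meetDepth.1 (show e ≤ P.meetDepth x y by omega)
  obtain ⟨h4, h5, h6⟩ := P.le_meetDepth.1 (show e ≤ P.meetDepth y z by omega)
  exact P.le_meetDepth.2 ⟨h1, h5, h3.trans h6⟩

theorem eq_of_meetDepth {x y : V} (hx : P.meetDepth x y = P.dep x) (hxy : P.dep x = P.dep y) :
    x = y := by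
  have := P.anc_meetDepth x y
  rwa [hx, P.anc_dep, hxy, P.anc_dep] at this

/-- The distance of `x` and `y` in the tree. -/
noncomputable def tdist (x y : V) : ℕ := P.dep x + P.dep y - 2 * P.meetDepth x y

theorem tdist_comm (x y : V) : P.tdist x y = P.tdist y x := by
  rw [tdist, tdist, P.meetDepth_comm, add_comm]

theorem tdist_add (x y : V) : P.tdist x y + 2 * P.meetDepth x y = P.dep x + P.dep y := by
  have h1 := P.meetDepth_le_left x y
  have h2 := P.meetDepth_le_right x y
  rw [tdist]; omega

/-- The four point condition. -/
theorem tdist_four_point (x y u v : V) :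
    P.tdist x y + P.tdist u v ≤
      max (P.tdist x u + P.tdist y v) (P.tdist x v + P.tdist y u) := by
  have := P.tdist_add x y
  have := P.tdist_add u v
  have := P.tdist_add x u
  have := P.tdist_add y v
  have := P.tdist_add x v
  have := P.tdist_add y u
  have h1 := P.min_meetDepth_le x u y
  have h2 := P.min_meetDepth_le x v y
  have h3 := P.min_meetDepth_le u x v
  have h4 := P.min_meetDepth_le u y v
  have h5 := P.min_meetDepth_le x u v
  have h6 := P.min_meetDepth_le x v u
  have h7 := P.min_meetDepth_le y u v
  have h8 := P.min_meetDepth_le y v u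
  have h9 := P.min_meetDepth_le x y u
  have h10 := P.min_meetDepth_le x y v
  have h11 := P.min_meetDepth_le y x u
  have h12 := P.min_meetDepth_le y x v
  have c1 := P.meetDepth_comm u y
  have c2 := P.meetDepth_comm v y
  have c3 := P.meetDepth_comm u x
  have c4 := P.meetDepth_comm v x
  have c5 := P.meetDepth_comm v u
  have c6 := P.meetDepth_comm y x
  omega

/-- A vertex that is not an ancestor of `v` is one step further from `v` than its parent. -/
theorem tdist_par {v x : V} (h : P.meetDepth x v < P.dep x) :
    P.tdist v (P.par x) + 1 = P.tdist v x := by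
  have h1 := P.tdist_add v (P.par x)
  have h2 := P.tdist_add v x
  rw [P.meetDepth_comm v, P.meetDepth_par (by omega), P.dep_par] at h1
  rw [P.meetDepth_comm v] at h2
  omega

/-- A set of diameter at most `z` lies in a ball of radius `⌈z / 2⌉`: the centre is that far above a
deepest vertex of the set. -/
theorem exists_center {K : Finset V} (hK : K.Nonempty) {z : ℕ}
    (h : ∀ x ∈ K, ∀ y ∈ K, P.tdist x y ≤ z) :
    ∃ c, ∀ y ∈ K, P.tdist c y ≤ (z + 1) / 2 := by
  obtain ⟨x, hx, hmax⟩ := K.exists_max_image P.dep hK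
  refine ⟨P.anc x (P.dep x - (z + 1) / 2), fun y hy => ?_⟩
  have h1 := P.tdist_add (P.anc x (P.dep x - (z + 1) / 2)) y
  rw [P.meetDepth_anc (by omega), P.dep_anc (by omega)] at h1
  have h2 := P.tdist_add x y
  have h3 := h x hx y hy
  have h4 := hmax y hy
  have h5 := P.meetDepth_le_right x y
  omega

/-- The tree distance bounds the distance in every graph that contains the edges of the tree. -/
theorem edist_le_tdist {G : SimpleGraph V} (hG : ∀ x, P.dep x ≠ 0 → G.Adj x (P.par x)) (x y : V) :
    G.edist x y ≤ P.tdist x y := by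
  have hup : ∀ k x, k ≤ P.dep x → G.edist x (P.par^[k] x) ≤ k := by
    intro k
    induction k with
    | zero => intro x _; simp
    | succ k ih =>
      intro x hk
      rw [Function.iterate_succ_apply]
      have h1 := ih (P.par x) (by rw [P.dep_par]; omega)
      have h2 : G.edist x (P.par x) = 1 := SimpleGraph.edist_eq_one_iff_adj.2 (hG x (by omega))
      calc _ ≤ G.edist x (P.par x) + G.edist (P.par x) (P.par^[k] (P.par x)) :=
            SimpleGraph.edist_triangle
        _ ≤ 1 + k := by rw [h2]; gcongr
        _ = _ := by push_cast; ring
  have h1 := P.meetDepth_le_left x y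
  have h2 := P.meetDepth_le_right x y
  have hx := hup (P.dep x - P.meetDepth x y) x (by omega)
  have hy := hup (P.dep y - P.meetDepth x y) y (by omega)
  have hm : P.par^[P.dep x - P.meetDepth x y] x = P.par^[P.dep y - P.meetDepth x y] y :=
    P.anc_meetDepth x y
  rw [hm] at hx
  rw [SimpleGraph.edist_comm] at hy
  calc _ ≤ _ := SimpleGraph.edist_triangle
    _ ≤ _ := add_le_add hx hy
    _ = _ := by
      rw [← Nat.cast_add]
      congr 1
      rw [tdist]; omega

end ParentTree

/-- Breadth-first search: a connected graph contains a rooted tree on all its vertices. -/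
theorem SimpleGraph.Connected.exists_parentTree {V : Type*} {G : SimpleGraph V}
    (hG : G.Connected) : ∃ P : ParentTree V, ∀ x, P.dep x ≠ 0 → G.Adj x (P.par x) := by
  classical
  obtain ⟨r⟩ := hG.nonempty
  have key : ∀ x, ∃ y, G.dist r y = G.dist r x - 1 ∧ (G.dist r x ≠ 0 → G.Adj x y) := by
    intro x
    obtain ⟨p, hp⟩ := hG.exists_walk_length_eq_dist x r
    cases p with
    | nil => exact ⟨r, by simp⟩
    | @cons _ y _ h q =>
      refine ⟨y, ?_, fun _ => h⟩
      have h1 : G.dist y r ≤ q.length := SimpleGraph.dist_le q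
      have h2 : G.dist r x ≤ G.dist r y + G.dist y x := hG.dist_triangle
      have h3 : G.dist y x = 1 := SimpleGraph.dist_eq_one_iff_adj.2 h.symm
      rw [SimpleGraph.Walk.length_cons, SimpleGraph.dist_comm] at hp
      rw [SimpleGraph.dist_comm] at h1
      omega
  choose f hf hf' using key
  exact ⟨⟨r, f, G.dist r, by simp, fun x hx => ((hG.dist_eq_zero_iff).1 hx).symm, hf⟩, hf'⟩

/-! ### Convexity of partial sums -/

open Finset in
/-- The partial sums `∑ z < n, s z`. -/
def partialSum (s : ℕ → ℝ) (n : ℕ) : ℝ := ∑ z ∈ range n, s z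

namespace partialSum

open Finset

variable {s : ℕ → ℝ}

@[simp] theorem zero : partialSum s 0 = 0 := by simp [partialSum]

theorem succ (n : ℕ) : partialSum s (n + 1) = partialSum s n + s n := sum_range_succ _ _

theorem sum_Ico {a b : ℕ} (h : a ≤ b) : ∑ z ∈ Ico a b, s z = partialSum s b - partialSum s a :=
  sum_Ico_eq_sub s h

theorem tangent_right (hs : Monotone s) {a b : ℕ} (h : a ≤ b) :
    partialSum s a + ((b : ℝ) - a) * s a ≤ partialSum s b := by
  induction b, h using Nat.le_induction with
  | base => simp
  | succ b hab ih =>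
    rw [succ]; push_cast
    linarith [hs hab]

theorem tangent_left (hs : Monotone s) {a b : ℕ} (h : a ≤ b) :
    partialSum s b ≤ partialSum s a + ((b : ℝ) - a) * s b := by
  induction b, h using Nat.le_induction with
  | base => simp
  | succ b hab ih =>
    rw [succ]; push_cast
    have h1 : (a : ℝ) ≤ b := by exact_mod_cast hab
    have h2 := hs (Nat.le_succ b)
    rw [Nat.succ_eq_add_one] at h2
    nlinarith

/-- The partial sums of a monotone sequence are convex. -/
theorem chord (hs : Monotone s) {a b c : ℕ} (hab : a ≤ b) (hbc : b ≤ c) :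
    partialSum s b * ((c : ℝ) - a) ≤
      ((c : ℝ) - b) * partialSum s a + ((b : ℝ) - a) * partialSum s c := by
  have h1 := tangent_left hs hab
  have h2 := tangent_right hs hbc
  have h3 : (a : ℝ) ≤ b := by exact_mod_cast hab
  have h4 : (b : ℝ) ≤ c := by exact_mod_cast hbc
  nlinarith [mul_le_mul_of_nonneg_left h1 (sub_nonneg.2 h4),
    mul_le_mul_of_nonneg_left h2 (sub_nonneg.2 h3)]

/-- If the partial sum up to `R` is below `R ^ 2 / 2`, then up to `R / 2` the partial sums lie below
a linear function which the partial sum at some `g ≤ R / 2` determines. -/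
theorem two_mul_le (hs : Monotone s) {R g x : ℕ} (hg : 2 * g ≤ R) (hx : 2 * x ≤ R)
    (hSR : partialSum s R < (R : ℝ) ^ 2 / 2) :
    2 * partialSum s x * ((R : ℝ) - g) ≤
      x * (((R : ℝ) - g) ^ 2 + (2 * partialSum s g - (g : ℝ) ^ 2)) := by
  have hR : (2 : ℝ) * g ≤ R := by exact_mod_cast hg
  have hR' : (2 : ℝ) * x ≤ R := by exact_mod_cast hx
  have hg0 : (0 : ℝ) ≤ g := Nat.cast_nonneg g
  have hx0 : (0 : ℝ) ≤ x := Nat.cast_nonneg x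
  have hV : 2 * partialSum s g - (g : ℝ) ^ 2 ≤ g * ((R : ℝ) - g) := by
    have h := chord hs (Nat.zero_le g) (show g ≤ R by omega)
    simp only [zero, Nat.cast_zero, sub_zero, mul_zero, zero_add] at h
    rcases Nat.eq_zero_or_pos R with rfl | hpos
    · obtain rfl : g = 0 := by omega
      simp
    · have hpos' : (0 : ℝ) < R := by exact_mod_cast hpos
      have : partialSum s g * R ≤ (g * R / 2) * R := by nlinarith
      have := le_of_mul_le_mul_right this hpos'
      nlinarith
  rcases le_total x g with h | h
  · rcases Nat.eq_zero_or_pos g with rfl | hpos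
    · obtain rfl : x = 0 := by omega
      simp
    · have hpos' : (0 : ℝ) < g := by exact_mod_cast hpos
      have h1 := chord hs (Nat.zero_le x) h
      simp only [zero, Nat.cast_zero, sub_zero, mul_zero, zero_add] at h1
      refine le_of_mul_le_mul_right ?_ hpos'
      have h2 : 0 ≤ ((R : ℝ) - 2 * g) * (g * ((R : ℝ) - g) - (2 * partialSum s g - (g : ℝ) ^ 2)) :=
        mul_nonneg (by linarith) (by linarith)
      nlinarith [mul_le_mul_of_nonneg_right h1 (show (0 : ℝ) ≤ R - g by linarith),
        mul_nonneg hx0 h2]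
  · have h1 := chord hs h (show x ≤ R by omega)
    have h2 : 0 ≤ ((R : ℝ) - 2 * x) * (g * ((R : ℝ) - g) - (2 * partialSum s g - (g : ℝ) ^ 2)) :=
      mul_nonneg (by linarith) (by linarith)
    have h3 : (g : ℝ) ≤ x := by exact_mod_cast h
    nlinarith [mul_le_mul_of_nonneg_left hSR.le (sub_nonneg.2 h3)]

/-- The numerical contradiction behind `ParentTree.Irreducible.sq_le`. There `R + g` is the
diameter of a subtree, `e₁` and `e₂` count the vertices that hang off its diametral path on either
side, and `α z`, `β z` are the costs of the branches that are not covered by a set of diameter `z`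
around one end of the path. -/
theorem not_lt_sq (hs : Monotone s) {R g e₁ e₂ : ℕ} {α β : ℕ → ℝ}
    (hSR : partialSum s R < (R : ℝ) ^ 2 / 2) (hSg : (g : ℝ) ^ 2 / 2 ≤ partialSum s g)
    (he₁ : 2 * e₁ ≤ R) (he₂ : 2 * e₂ ≤ R) (he : g + (e₁ + e₂) < R)
    (hα : ∀ I : Finset ℕ, ∑ z ∈ I, α z ≤ partialSum s e₁ + partialSum s e₂)
    (hα' : ∀ I : Finset ℕ, ∑ z ∈ I, α z ≤ partialSum s (e₁ + e₂))
    (hβ : ∀ I : Finset ℕ, ∑ z ∈ I, β z ≤ partialSum s e₁ + partialSum s e₂)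
    (hβ' : ∀ I : Finset ℕ, ∑ z ∈ I, β z ≤ partialSum s (e₁ + e₂))
    (hlarge : ∀ z, g ≤ z → z < R →
      (R : ℝ) + g + (e₁ + e₂) ≤ s z + s (R + g - 1 - z) + α z + β (R + g - 1 - z))
    (hsmall : ∀ z < g, (z : ℝ) + 1 ≤ s z + α z ∧ (z : ℝ) + 1 ≤ s z + β z) : False := by
  have heR : (g : ℝ) + (e₁ + e₂) < R := by exact_mod_cast he
  have hg0 : (0 : ℝ) ≤ g := Nat.cast_nonneg g
  have h10 : (0 : ℝ) ≤ e₁ := Nat.cast_nonneg _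
  have h20 : (0 : ℝ) ≤ e₂ := Nat.cast_nonneg _
  have hrefl : ∀ f : ℕ → ℝ, ∑ z ∈ Ico g R, f (R + g - 1 - z) = ∑ z ∈ Ico g R, f z := by
    intro f
    have := sum_Ico_reflect f g (show R ≤ (R + g - 1) + 1 by omega)
    rw [this]
    congr 2 <;> omega
  have hsum : ((R : ℝ) - g) * ((R : ℝ) + g + (e₁ + e₂)) ≤
      2 * (partialSum s R - partialSum s g) + ∑ z ∈ Ico g R, α z + ∑ z ∈ Ico g R, β z := by
    have h : ∑ z ∈ Ico g R, ((R : ℝ) + g + (e₁ + e₂)) ≤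
        ∑ z ∈ Ico g R, (s z + s (R + g - 1 - z) + α z + β (R + g - 1 - z)) :=
      sum_le_sum fun z hz => hlarge z (mem_Ico.1 hz).1 (mem_Ico.1 hz).2
    rw [sum_const, Nat.card_Ico, nsmul_eq_mul, sum_add_distrib, sum_add_distrib, sum_add_distrib,
      hrefl s, hrefl β, sum_Ico (show g ≤ R by omega)] at h
    rw [Nat.cast_sub (by omega)] at h
    nlinarith
  rcases le_or_gt (2 * g) R with hgR | hgR
  · have h1 := hα (Ico g R)
    have h2 := hβ (Ico g R)
    have h3 := two_mul_le hs hgR he₁ hSR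
    have h4 := two_mul_le hs hgR he₂ hSR
    set V := 2 * partialSum s g - (g : ℝ) ^ 2 with hV
    have hV0 : 0 ≤ V := by linarith
    have h5 : V + ((R : ℝ) - g) * (e₁ + e₂) < 2 * (partialSum s e₁ + partialSum s e₂) := by
      nlinarith
    have h6 := mul_lt_mul_of_pos_right h5 (show (0 : ℝ) < R - g by linarith)
    nlinarith [mul_nonneg hV0 (show (0 : ℝ) ≤ R - g - (e₁ + e₂) by linarith)]
  · have heg : e₁ + e₂ ≤ g := by omega
    have hsq : ∀ γ : ℕ → ℝ, (∀ z < g, (z : ℝ) + 1 ≤ s z + γ z) →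
        (g : ℝ) ^ 2 / 2 - ((e₁ + e₂ : ℕ) : ℝ) ^ 2 / 2 ≤
          partialSum s g - partialSum s (e₁ + e₂) + ∑ z ∈ Ico (e₁ + e₂) g, γ z := by
      intro γ hγ
      have h := sum_le_sum fun z (hz : z ∈ Ico (e₁ + e₂) g) =>
        show ((z + 1 : ℕ) : ℝ) ^ 2 / 2 - (z : ℝ) ^ 2 / 2 ≤ s z + γ z by
          have := hγ z (mem_Ico.1 hz).2
          push_cast
          nlinarith
      rwa [sum_Ico_sub (fun z : ℕ => (z : ℝ) ^ 2 / 2) heg, sum_add_distrib, sum_Ico heg] at h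
    have h1 := hsq α fun z hz => (hsmall z hz).1
    have h2 := hsq β fun z hz => (hsmall z hz).2
    have h3 := hα' (Ico (e₁ + e₂) R)
    have h4 := hβ' (Ico (e₁ + e₂) R)
    rw [← sum_Ico_consecutive _ heg (show g ≤ R by omega)] at h3 h4
    push_cast at h1 h2
    nlinarith [mul_nonneg (add_nonneg h10 h20) (show (0 : ℝ) ≤ R - g - (e₁ + e₂) by linarith)]

end partialSum

/-! ### Subtrees and irreducible trees -/

namespace ParentTree

open Finset

variable {V : Type*} (P : ParentTree V)

/-- The vertices of `T` that are `p` or a descendant of `p`. -/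
noncomputable def below (T : Finset V) (p : V) : Finset V :=
  T.filter fun x => P.meetDepth p x = P.dep p

/-- The diameter of the subtree of `T` at `p`. -/
noncomputable def diam (T : Finset V) (p : V) : ℕ :=
  (P.below T p ×ˢ P.below T p).sup fun x => P.tdist x.1 x.2

/-- `T` contains the parents of its vertices. -/
def ParClosed (T : Finset V) : Prop := ∀ x ∈ T, P.par x ∈ T

/-- `D` is a set of vertices of `T` that contains their children in `T`. -/
def DownClosed (T D : Finset V) : Prop := D ⊆ T ∧ ∀ y ∈ T, P.par y ∈ D → y ∈ D

variable {P} {T D : Finset V}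

theorem mem_below {p x : V} : x ∈ P.below T p ↔ x ∈ T ∧ P.meetDepth p x = P.dep p := by
  simp [below]

theorem mem_below_self {p : V} (h : p ∈ T) : p ∈ P.below T p := by simp [mem_below, h]

theorem mem_below_anc {v x : V} {k : ℕ} (h : k ≤ P.dep v) :
    x ∈ P.below T (P.anc v k) ↔ x ∈ T ∧ k ≤ P.meetDepth v x := by
  rw [mem_below, P.meetDepth_anc h, P.dep_anc h]
  simp

theorem tdist_le_diam {p x y : V} (hx : x ∈ P.below T p) (hy : y ∈ P.below T p) :
    P.tdist x y ≤ P.diam T p :=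
  Finset.le_sup (f := fun x : V × V => P.tdist x.1 x.2) (mem_product.2 ⟨hx, hy⟩ : (x, y) ∈ _)

theorem exists_tdist_eq_diam {p : V} (hp : p ∈ T) :
    ∃ x ∈ P.below T p, ∃ y ∈ P.below T p, P.tdist x y = P.diam T p := by
  have hne : (P.below T p ×ˢ P.below T p).Nonempty :=
    ⟨(p, p), mem_product.2 ⟨mem_below_self hp, mem_below_self hp⟩⟩
  obtain ⟨⟨x, y⟩, h, h'⟩ := exists_mem_eq_sup _ hne fun x : V × V => P.tdist x.1 x.2
  exact ⟨x, (mem_product.1 h).1, y, (mem_product.1 h).2, h'.symm⟩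

theorem par_eq_self {x : V} (h : P.dep x = 0) : P.par x = x :=
  (P.eq_root _ (by rw [P.dep_par, h])).trans (P.eq_root _ h).symm

theorem meetDepth_par_le (x y : V) : P.meetDepth x (P.par y) ≤ P.meetDepth x y := by
  by_cases h : P.dep y = 0
  · rw [par_eq_self h]
  · rw [P.meetDepth_comm x, P.meetDepth_comm x, P.meetDepth_par h]
    exact min_le_left _ _

theorem DownClosed.below {p : V} : P.DownClosed T (P.below T p) := by
  refine ⟨filter_subset _ _, fun y hy h => ?_⟩
  rw [mem_below] at h ⊢
  have h1 := P.meetDepth_par_le p y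
  have h2 := P.meetDepth_le_left p y
  exact ⟨hy, by omega⟩

theorem ParClosed.anc (hT : P.ParClosed T) {x : V} (hx : x ∈ T) (k : ℕ) : P.anc x k ∈ T := by
  rw [ParentTree.anc]
  generalize P.dep x - k = i
  induction i with
  | zero => simpa
  | succ i ih => rw [Function.iterate_succ_apply']; exact hT _ ih

/-- The members of a set of vertices `B` lie below members of `G ∩ B`, if the parent of every vertex
of `B \ G` lies in `B`. -/
theorem exists_ancestor {B G : V → Prop}
    (h : ∀ x, B x → ¬ G x → P.dep x ≠ 0 ∧ B (P.par x)) {x : V} (hx : B x) :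
    ∃ y, B y ∧ G y ∧ P.meetDepth y x = P.dep y := by
  induction hn : P.dep x using Nat.strong_induction_on generalizing x with
  | _ n ih =>
    by_cases hG : G x
    · exact ⟨x, hx, hG, by simp⟩
    · obtain ⟨h0, hB⟩ := h x hx hG
      obtain ⟨y, hy, hyG, hyx⟩ := ih (P.dep (P.par x)) (by rw [P.dep_par]; omega) hB rfl
      refine ⟨y, hy, hyG, ?_⟩
      have h1 := P.meetDepth_par_le y x
      have h2 := P.meetDepth_le_left y x
      omega

theorem DownClosed.below_subset (hT : P.ParClosed T) (hD : P.DownClosed T D) {x : V}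
    (hx : x ∈ D) : P.below T x ⊆ D := by
  intro y hy
  induction hn : P.dep y using Nat.strong_induction_on generalizing y with
  | _ n ih =>
    obtain ⟨hyT, hyx⟩ := mem_below.1 hy
    have hle := P.meetDepth_le_right x y
    by_cases h : P.dep x = P.dep y
    · rwa [← P.eq_of_meetDepth hyx h]
    · refine hD.2 y hyT (ih (P.dep (P.par y)) (by rw [P.dep_par]; omega) ?_ rfl)
      refine mem_below.2 ⟨hT y hyT, ?_⟩
      rw [P.meetDepth_comm, P.meetDepth_par (by omega), P.meetDepth_comm]
      omega

/-- The ancestors of `x` at depths in `[a, b)` are distinct. -/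
theorem card_ge_of_anc_mem {F : Finset V} {x : V} {a b : ℕ} (hb : b ≤ P.dep x + 1)
    (h : ∀ i, a ≤ i → i < b → P.anc x i ∈ F) : b - a ≤ F.card := by
  rw [← Nat.card_Ico]
  refine card_le_card_of_injOn (P.anc x) (fun i hi => ?_) fun i hi j hj hij => ?_
  · rw [coe_Ico] at hi
    exact h i hi.1 hi.2
  · rw [coe_Ico] at hi hj
    have h1 := P.dep_anc (show i ≤ P.dep x by have := hi.2; omega)
    have h2 := P.dep_anc (show j ≤ P.dep x by have := hj.2; omega)
    rw [← h1, ← h2, hij]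

/-- A subtree contains a path as long as its diameter. -/
theorem diam_lt_card_below (hT : P.ParClosed T) {p : V} (hp : p ∈ T) :
    P.diam T p + 1 ≤ (P.below T p).card := by
  classical
  obtain ⟨x, hx, y, hy, hxy⟩ := exists_tdist_eq_diam (P := P) hp
  obtain ⟨hxT, hx⟩ := mem_below.1 hx
  obtain ⟨hyT, hy⟩ := mem_below.1 hy
  have h1 := P.tdist_add x y
  have h2 := P.min_meetDepth_le x p y
  have h3 := P.meetDepth_comm x p
  have hmx := P.meetDepth_le_left x y
  have hmy := P.meetDepth_le_right x y
  set m := P.meetDepth x y with hm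
  have key : ∀ w, w ∈ T → P.meetDepth p w = P.dep p → ∀ i, m ≤ i → i ≤ P.dep w →
      P.anc w i ∈ P.below T p := by
    intro w hw hpw i hi hi'
    refine mem_below.2 ⟨hT.anc hw i, ?_⟩
    rw [P.meetDepth_comm, P.meetDepth_anc hi', P.meetDepth_comm, hpw]
    omega
  have hX : P.dep x + 1 - m ≤ ((P.below T p).filter fun w => P.meetDepth w x = P.dep w).card := by
    refine card_ge_of_anc_mem (P := P) le_rfl fun i hi hi' => mem_filter.2 ⟨?_, ?_⟩
    · exact key x hxT hx i hi (by omega)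
    · rw [P.meetDepth_anc (by omega), P.dep_anc (by omega), P.meetDepth_self]; omega
  have hY : P.dep y + 1 - (m + 1) ≤
      ((P.below T p).filter fun w => ¬ P.meetDepth w x = P.dep w).card := by
    refine card_ge_of_anc_mem (P := P) le_rfl fun i hi hi' => mem_filter.2 ⟨?_, ?_⟩
    · exact key y hyT hy i (by omega) (by omega)
    · rw [P.meetDepth_anc (by omega), P.dep_anc (by omega), P.meetDepth_comm, ← hm]; omega
  have := card_filter_add_card_filter_not (s := P.below T p) fun w => P.meetDepth w x = P.dep w
  omega

/-- The subtrees at the vertices of a forest with `n` vertices have diameters at most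
`0, 1, …, n - 1` in some order, since each subtree has more vertices than its diameter. -/
theorem sum_diam_le (hT : P.ParClosed T) {s : ℕ → ℝ} (hs : Monotone s) (hD : P.DownClosed T D) :
    ∑ x ∈ D, s (P.diam T x) ≤ partialSum s D.card := by
  classical
  induction hn : D.card generalizing D with
  | zero => rw [card_eq_zero.1 hn]; simp
  | succ n ih =>
    obtain ⟨x, hx, hmin⟩ := D.exists_min_image P.dep (card_pos.1 (by omega))
    have hx' : P.diam T x ≤ n := by
      have h1 := diam_lt_card_below hT (hD.1 hx)
      have h2 := card_le_card (hD.below_subset hT hx)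
      omega
    have hcard : (D.erase x).card = n := by rw [card_erase_of_mem hx, hn]; rfl
    have hD' : P.DownClosed T (D.erase x) := by
      refine ⟨(erase_subset _ _).trans hD.1, fun y hy h => mem_erase.2 ⟨?_, ?_⟩⟩
      · rintro rfl
        obtain ⟨h1, h2⟩ := mem_erase.1 h
        have h3 := hmin _ h2
        rw [P.dep_par] at h3
        exact h1 (par_eq_self (by omega))
      · exact hD.2 y hy (mem_of_mem_erase h)
    rw [← add_sum_erase _ _ hx, partialSum.succ]
    linarith [ih hD' hcard, hs hx']

/-- `s` is the price of covering a set of given diameter, and `T` is irreducible if no descending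
part `D` of `T` can be covered at a price below `|D|`. The allowed covers consist of sets of
diameter less than `r`; they have one member, or `D` has at most `2 * r` vertices, so that a cheap
cover has few members. -/
def Irreducible (P : ParentTree V) (T : Finset V) (s : ℕ → ℝ) (r : ℕ) : Prop :=
  ∀ D, P.DownClosed T D → ∀ M : Multiset (Finset V × ℕ),
    (∀ K ∈ M, K.2 < r ∧ ∀ x ∈ K.1, ∀ y ∈ K.1, P.tdist x y ≤ K.2) →
    (∀ x ∈ D, ∃ K ∈ M, x ∈ K.1) → (M.card = 1 ∨ D.card ≤ 2 * r) →
    (D.card : ℝ) ≤ (M.map fun K => s K.2).sum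

theorem Irreducible.card_below_le {s : ℕ → ℝ} {r : ℕ} (hI : P.Irreducible T s r) {p : V}
    (hp : P.diam T p < r) : ((P.below T p).card : ℝ) ≤ s (P.diam T p) := by
  have := hI (P.below T p) .below {(P.below T p, P.diam T p)}
    (by simpa using ⟨hp, fun x hx y hy => tdist_le_diam hx hy⟩) (by simp) (by simp)
  simpa using this

end ParentTree

/-! ### The price bound for irreducible trees -/

namespace ParentTree

open Finset

variable {V : Type*} (P : ParentTree V)

/-- The vertices of `T` that share with `v` their ancestor at depth `k + 1`. -/
noncomputable def branch (T : Finset V) (v : V) (k : ℕ) : Finset V :=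
  T.filter fun x => k < P.meetDepth v x

/-- The vertices of `P.branch T v k` that are not ancestors of `v`. -/
noncomputable def hang (T : Finset V) (v : V) (k : ℕ) : Finset V :=
  T.filter fun x => k < P.meetDepth v x ∧ P.meetDepth v x < P.dep x

/-- The price of covering, each by itself, the subtrees at the vertices of `X` whose distance from
`v` is `z + 1`. -/
noncomputable def cost (T : Finset V) (s : ℕ → ℝ) (X : Finset V) (v : V) (z : ℕ) : ℝ :=
  ∑ x ∈ X with P.tdist v x = z + 1, s (P.diam T x)

variable {P} {T : Finset V} {s : ℕ → ℝ} {r : ℕ} {v w : V} {k : ℕ}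

theorem mem_branch {x : V} : x ∈ P.branch T v k ↔ x ∈ T ∧ k < P.meetDepth v x := by
  simp [branch]

theorem mem_hang {x : V} :
    x ∈ P.hang T v k ↔ x ∈ T ∧ k < P.meetDepth v x ∧ P.meetDepth v x < P.dep x := by
  simp [hang]

theorem DownClosed.branch : P.DownClosed T (P.branch T v k) := by
  refine ⟨filter_subset _ _, fun y hy h => ?_⟩
  rw [mem_branch] at h ⊢
  exact ⟨hy, h.2.trans_le (P.meetDepth_par_le v y)⟩

theorem DownClosed.hang : P.DownClosed T (P.hang T v k) := by
  refine ⟨filter_subset _ _, fun y hy h => ?_⟩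
  rw [mem_hang] at h ⊢
  have h1 := P.meetDepth_par_le v y
  have h2 := P.meetDepth_le_right v y
  obtain ⟨-, h3, h4⟩ := h
  rw [P.dep_par] at h4
  rw [P.meetDepth_comm, P.meetDepth_par (by omega), P.meetDepth_comm] at h4
  exact ⟨hy, by omega, by omega⟩

theorem DownClosed.union [DecidableEq V] {D E : Finset V} (hD : P.DownClosed T D)
    (hE : P.DownClosed T E) : P.DownClosed T (D ∪ E) := by
  refine ⟨union_subset hD.1 hE.1, fun y hy h => ?_⟩
  rw [mem_union] at h ⊢
  exact h.imp (hD.2 y hy) (hE.2 y hy)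

theorem branch_eq_below (h : k < P.dep v) : P.branch T v k = P.below T (P.anc v (k + 1)) := by
  ext x
  rw [mem_branch, mem_below_anc (by omega)]
  rfl

theorem card_hang_le (hT : P.ParClosed T) (hv : v ∈ T) :
    P.dep v - k + (P.hang T v k).card ≤ (P.branch T v k).card := by
  have h1 : P.dep v + 1 - (k + 1) ≤
      ((P.branch T v k).filter fun x => ¬ P.meetDepth v x < P.dep x).card := by
    refine card_ge_of_anc_mem (P := P) le_rfl fun i hi hi' => mem_filter.2 ?_
    rw [mem_branch, P.meetDepth_comm, P.meetDepth_anc (by omega), P.dep_anc (by omega),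
      P.meetDepth_self]
    exact ⟨⟨hT.anc hv i, by omega⟩, by omega⟩
  have h2 : P.hang T v k = (P.branch T v k).filter fun x => P.meetDepth v x < P.dep x := by
    rw [hang, branch, filter_filter]
  have := card_filter_add_card_filter_not (s := P.branch T v k) fun x => P.meetDepth v x < P.dep x
  rw [h2]
  omega

theorem sum_cost_le (hs0 : ∀ z, 0 ≤ s z) {X : Finset V}
    (I : Finset ℕ) : ∑ z ∈ I, P.cost T s X v z ≤ ∑ x ∈ X, s (P.diam T x) := by
  simp only [cost, sum_filter]
  rw [sum_comm]
  refine sum_le_sum fun x _ => ?_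
  rcases Nat.eq_zero_or_pos (P.tdist v x) with h | h
  · rw [sum_eq_zero fun z _ => if_neg (by omega)]
    exact hs0 _
  · have : ∀ z, (if P.tdist v x = z + 1 then s (P.diam T x) else 0) =
        if P.tdist v x - 1 = z then s (P.diam T x) else 0 := fun z => by
      congr 1
      exact propext (by omega)
    simp only [this, sum_ite_eq]
    split_ifs
    exacts [le_rfl, hs0 _]

theorem cost_mono (hs0 : ∀ z, 0 ≤ s z) {X Y : Finset V} (h : X ⊆ Y) (z : ℕ) :
    P.cost T s X v z ≤ P.cost T s Y v z :=
  sum_le_sum_of_subset_of_nonneg (filter_subset_filter _ h) fun _ _ _ => hs0 _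

/-- Two branches that end in `v` and `w`, the ends of a diametral path of the subtree at their last
common ancestor, can be covered by the vertices within `z` of `v`, those within `d - 1 - z` of `w`,
and the subtrees just outside. By the four point condition the first two sets have diameters at most
`z` and `d - 1 - z`. -/
theorem Irreducible.card_branch_add_card_branch_le [DecidableEq V] (hT : P.ParClosed T)
    (hI : P.Irreducible T s r)
    (hd : ∀ x ∈ T, P.meetDepth v w ≤ P.meetDepth v x →
      P.tdist v x ≤ P.tdist v w ∧ P.tdist w x ≤ P.tdist v w)
    (hdiam : ∀ x ∈ T, P.meetDepth v w < P.dep x → P.diam T x < r)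
    (hcard : (P.branch T v (P.meetDepth v w)).card + (P.branch T w (P.meetDepth v w)).card ≤ 2 * r)
    {z : ℕ} (hz : z < P.tdist v w) (hzr : z < r) (hzr' : P.tdist v w - 1 - z < r) :
    ((P.branch T v (P.meetDepth v w)).card : ℝ) + (P.branch T w (P.meetDepth v w)).card ≤
      s z + s (P.tdist v w - 1 - z) +
        P.cost T s (P.hang T v (P.meetDepth v w) ∪ P.hang T w (P.meetDepth v w)) v z +
        P.cost T s (P.hang T v (P.meetDepth v w) ∪ P.hang T w (P.meetDepth v w)) w
          (P.tdist v w - 1 - z) := by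
  set k := P.meetDepth v w with hk
  set d := P.tdist v w with hd'
  set X := P.hang T v k ∪ P.hang T w k with hX
  set D := P.branch T v k ∪ P.branch T w k with hD
  have hdisj : Disjoint (P.branch T v k) (P.branch T w k) := by
    rw [disjoint_left]
    intro x hx hx'
    have h1 := (mem_branch.1 hx).2
    have h2 := (mem_branch.1 hx').2
    have h3 := P.min_meetDepth_le v x w
    have h4 := P.meetDepth_comm x w
    omega
  have hDcard : D.card = (P.branch T v k).card + (P.branch T w k).card :=
    card_union_of_disjoint hdisj
  have hDd : ∀ x ∈ D, P.tdist v x ≤ d ∧ P.tdist w x ≤ d := by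
    intro x hx
    rcases mem_union.1 hx with h | h
    · exact hd x (mem_branch.1 h).1 (mem_branch.1 h).2.le
    · have h1 := (mem_branch.1 h).2
      have h2 := P.min_meetDepth_le v w x
      exact hd x (mem_branch.1 h).1 (by omega)
  let K₁ := D.filter fun x => P.tdist v x ≤ z
  let K₂ := D.filter fun x => P.tdist w x ≤ d - 1 - z
  let E₁ := X.filter fun x => P.tdist v x = z + 1
  let E₂ := X.filter fun x => P.tdist w x = d - 1 - z + 1
  have hXT : ∀ x ∈ X, x ∈ T ∧ k < P.dep x := by
    intro x hx
    rcases mem_union.1 hx with h | h <;> obtain ⟨h1, h2, h3⟩ := mem_hang.1 h <;>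
      exact ⟨h1, h2.trans h3⟩
  have hEdiam : ∀ x ∈ X, P.diam T x < r ∧
      ∀ y ∈ P.below T x, ∀ y' ∈ P.below T x, P.tdist y y' ≤ P.diam T x := fun x hx =>
    ⟨hdiam x (hXT x hx).1 (hXT x hx).2, fun y hy y' hy' => tdist_le_diam hy hy'⟩
  have hmain := hI D (DownClosed.union .branch .branch)
    ((K₁, z) ::ₘ (K₂, d - 1 - z) ::ₘ (E₁.val.map (fun x => (P.below T x, P.diam T x)) +
      E₂.val.map fun x => (P.below T x, P.diam T x))) ?_ ?_ (Or.inr (by omega))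
  · rw [hDcard] at hmain
    simp only [Multiset.map_cons, Multiset.sum_cons, Multiset.map_add, Multiset.sum_add,
      Multiset.map_map, Function.comp_def] at hmain
    push_cast at hmain
    have e1 : P.cost T s X v z = (E₁.val.map fun x => s (P.diam T x)).sum := rfl
    have e2 : P.cost T s X w (d - 1 - z) = (E₂.val.map fun x => s (P.diam T x)).sum := rfl
    rw [e1, e2]
    linarith
  · intro K hK
    simp only [Multiset.mem_cons, Multiset.mem_add, Multiset.mem_map, mem_val] at hK
    rcases hK with rfl | rfl | ⟨x, hx, rfl⟩ | ⟨x, hx, rfl⟩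
    · refine ⟨hzr, fun x hx y hy => ?_⟩
      obtain ⟨hxD, hx⟩ := mem_filter.1 hx
      obtain ⟨hyD, hy⟩ := mem_filter.1 hy
      have h1 := P.tdist_four_point x y v w
      rw [P.tdist_comm x v, P.tdist_comm x w, P.tdist_comm y v, P.tdist_comm y w] at h1
      have h2 := hDd x hxD
      have h3 := hDd y hyD
      omega
    · refine ⟨hzr', fun x hx y hy => ?_⟩
      obtain ⟨hxD, hx⟩ := mem_filter.1 hx
      obtain ⟨hyD, hy⟩ := mem_filter.1 hy
      have h1 := P.tdist_four_point x y v w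
      rw [P.tdist_comm x v, P.tdist_comm x w, P.tdist_comm y v, P.tdist_comm y w] at h1
      have h2 := hDd x hxD
      have h3 := hDd y hyD
      dsimp only
      omega
    · exact hEdiam x (mem_filter.1 hx).1
    · exact hEdiam x (mem_filter.1 hx).1
  · intro x hx
    by_cases h1 : P.tdist v x ≤ z
    · exact ⟨(K₁, z), by simp, mem_filter.2 ⟨hx, h1⟩⟩
    by_cases h2 : P.tdist w x ≤ d - 1 - z
    · exact ⟨(K₂, d - 1 - z), by simp, mem_filter.2 ⟨hx, h2⟩⟩
    -- a vertex outside of both sets is not on the path from `v` to `w`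
    have hside : ∀ {a b y : V}, P.meetDepth a b = k → P.tdist a b = d → k < P.meetDepth a y →
        d < P.tdist a y + P.tdist b y → P.meetDepth b y ≤ k ∧ P.meetDepth a y < P.dep y := by
      intro a b y hab hab' hay hy
      have e1 := P.tdist_add a b
      have e2 := P.tdist_add a y
      have e3 := P.tdist_add b y
      have e4 := P.min_meetDepth_le a y b
      have e5 := P.meetDepth_comm y b
      have e6 := P.min_meetDepth_le b a y
      have e7 := P.meetDepth_comm a b
      have e8 := P.meetDepth_le_right a y
      exact ⟨by omega, by omega⟩
    have hBX : ∀ y, y ∈ D → d < P.tdist v y + P.tdist w y →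
        y ∈ X ∧ P.dep y ≠ 0 ∧ P.tdist v (P.par y) + 1 = P.tdist v y ∧
          P.tdist w (P.par y) + 1 = P.tdist w y ∧ P.par y ∈ D := by
      intro y hy hyd
      rcases mem_union.1 hy with h | h
      · obtain ⟨hyT, hky⟩ := mem_branch.1 h
        obtain ⟨g1, g2⟩ := hside hk.symm hd'.symm hky hyd
        refine ⟨mem_union_left _ (mem_hang.2 ⟨hyT, hky, g2⟩), by omega,
          P.tdist_par (by rwa [P.meetDepth_comm]), P.tdist_par (by rw [P.meetDepth_comm]; omega),
          mem_union_left _ (mem_branch.2 ⟨hT _ hyT, ?_⟩)⟩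
        rw [P.meetDepth_comm, P.meetDepth_par (by omega), P.meetDepth_comm]
        omega
      · obtain ⟨hyT, hky⟩ := mem_branch.1 h
        obtain ⟨g1, g2⟩ := hside (by rw [P.meetDepth_comm]) (by rw [P.tdist_comm]) hky
          (by rwa [add_comm])
        refine ⟨mem_union_right _ (mem_hang.2 ⟨hyT, hky, g2⟩), by omega,
          P.tdist_par (by rw [P.meetDepth_comm]; omega), P.tdist_par (by rwa [P.meetDepth_comm]),
          mem_union_right _ (mem_branch.2 ⟨hT _ hyT, ?_⟩)⟩
        rw [P.meetDepth_comm, P.meetDepth_par (by omega), P.meetDepth_comm]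
        omega
    obtain ⟨y, ⟨hyD, hy1, hy2⟩, hyG, hyx⟩ := exists_ancestor (P := P)
      (B := fun y => y ∈ D ∧ z + 1 ≤ P.tdist v y ∧ d - z ≤ P.tdist w y)
      (G := fun y => P.tdist v y = z + 1 ∨ P.tdist w y = d - 1 - z + 1)
      (by
        rintro y ⟨hyD, hy1, hy2⟩ hG
        obtain ⟨-, g2, g3, g4, g5⟩ := hBX y hyD (by omega)
        exact ⟨g2, g5, by omega, by omega⟩) (x := x) ⟨hx, by omega, by omega⟩
    have hyX := (hBX y hyD (by omega)).1
    have hxT : x ∈ T := by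
      rcases mem_union.1 hx with h | h <;> exact (mem_branch.1 h).1
    have hbel : x ∈ P.below T y := mem_below.2 ⟨hxT, hyx⟩
    refine ⟨(P.below T y, P.diam T y), ?_, hbel⟩
    simp only [Multiset.mem_cons, Multiset.mem_add, Multiset.mem_map, mem_val]
    rcases hyG with h | h
    · exact Or.inr (Or.inr (Or.inl ⟨y, mem_filter.2 ⟨hyX, h⟩, rfl⟩))
    · exact Or.inr (Or.inr (Or.inr ⟨y, mem_filter.2 ⟨hyX, h⟩, rfl⟩))

/-- The descendants of the ancestor of `v` at distance `z` can be covered by those within `z` of `v`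
and the subtrees just outside. -/
theorem Irreducible.succ_le_add_cost (hT : P.ParClosed T) (hs0 : ∀ z, 0 ≤ s z)
    (hI : P.Irreducible T s r) (hv : v ∈ T)
    (hd : ∀ x ∈ T, P.meetDepth v w ≤ P.meetDepth v x →
      P.tdist v x ≤ P.tdist v w ∧ P.tdist w x ≤ P.tdist v w)
    (hdiam : ∀ x ∈ T, P.meetDepth v w < P.dep x → P.diam T x < r)
    (hcard : (P.branch T v (P.meetDepth v w)).card ≤ 2 * r) {X : Finset V}
    (hX : P.hang T v (P.meetDepth v w) ⊆ X) {z : ℕ} (hz : P.meetDepth v w + z < P.dep v)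
    (hzr : z < r) : (z : ℝ) + 1 ≤ s z + P.cost T s X v z := by
  refine le_trans ?_ (add_le_add_right (cost_mono hs0 hX z) (s z))
  set k := P.meetDepth v w with hk
  set p := P.anc v (P.dep v - z)
  let K := (P.below T p).filter fun x => P.tdist v x ≤ z
  let E := (P.hang T v k).filter fun x => P.tdist v x = z + 1
  have hp : ∀ {x}, x ∈ P.below T p ↔ x ∈ T ∧ P.dep v - z ≤ P.meetDepth v x :=
    mem_below_anc (by omega)
  have hle : (P.below T p).card ≤ (P.branch T v k).card := card_le_card fun x hx =>
    mem_branch.2 ⟨(hp.1 hx).1, by have := (hp.1 hx).2; omega⟩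
  have hge : z + 1 ≤ (P.below T p).card := by
    have := card_ge_of_anc_mem (P := P) (F := P.below T p) (x := v) (a := P.dep v - z) le_rfl
      fun i hi hi' => hp.2 ⟨hT.anc hv i, by
        rw [P.meetDepth_comm, P.meetDepth_anc (by omega), P.meetDepth_self]; omega⟩
    omega
  have hmain := hI (P.below T p) .below
    ((K, z) ::ₘ E.val.map fun x => (P.below T x, P.diam T x)) ?_ ?_ (Or.inr (by omega))
  · simp only [Multiset.map_cons, Multiset.sum_cons, Multiset.map_map, Function.comp_def] at hmain
    have e1 : P.cost T s (P.hang T v k) v z = (E.val.map fun x => s (P.diam T x)).sum := rfl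
    rw [e1]
    refine le_trans ?_ hmain
    exact_mod_cast hge
  · intro L hL
    simp only [Multiset.mem_cons, Multiset.mem_map, mem_val] at hL
    rcases hL with rfl | ⟨x, hx, rfl⟩
    · refine ⟨hzr, fun x hx y hy => ?_⟩
      obtain ⟨hxD, hx⟩ := mem_filter.1 hx
      obtain ⟨hyD, hy⟩ := mem_filter.1 hy
      have h1 := P.tdist_four_point x y v w
      rw [P.tdist_comm x v, P.tdist_comm x w, P.tdist_comm y v, P.tdist_comm y w] at h1
      have h2 := hd x (hp.1 hxD).1 (by have := (hp.1 hxD).2; omega)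
      have h3 := hd y (hp.1 hyD).1 (by have := (hp.1 hyD).2; omega)
      dsimp only
      omega
    · obtain ⟨h1, h2, h3⟩ := mem_hang.1 (mem_filter.1 hx).1
      exact ⟨hdiam x h1 (h2.trans h3), fun y hy y' hy' => tdist_le_diam hy hy'⟩
  · intro x hx
    by_cases h1 : P.tdist v x ≤ z
    · exact ⟨(K, z), by simp, mem_filter.2 ⟨hx, h1⟩⟩
    have hB : ∀ y, y ∈ P.below T p → z + 1 ≤ P.tdist v y → P.meetDepth v y < P.dep y := by
      intro y hy hyz
      have g1 := (hp.1 hy).2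
      have g2 := P.tdist_add v y
      have g3 := P.meetDepth_le_right v y
      omega
    obtain ⟨y, ⟨hyD, hy1⟩, hyG, hyx⟩ := exists_ancestor (P := P)
      (B := fun y => y ∈ P.below T p ∧ z + 1 ≤ P.tdist v y)
      (G := fun y => P.tdist v y = z + 1)
      (by
        rintro y ⟨hyD, hy1⟩ hG
        have g1 := hB y hyD hy1
        have g2 := P.tdist_par (v := v) (x := y) (by rwa [P.meetDepth_comm])
        obtain ⟨hyT, g3⟩ := hp.1 hyD
        refine ⟨by omega, hp.2 ⟨hT _ hyT, ?_⟩, by omega⟩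
        rw [P.meetDepth_comm, P.meetDepth_par (by omega), P.meetDepth_comm]
        omega) (x := x) ⟨hx, by omega⟩
    obtain ⟨hyT, hyk⟩ := hp.1 hyD
    refine ⟨(P.below T y, P.diam T y), ?_, mem_below.2 ⟨(hp.1 hx).1, hyx⟩⟩
    simp only [Multiset.mem_cons, Multiset.mem_map, mem_val]
    exact Or.inr ⟨y, mem_filter.2 ⟨mem_hang.2 ⟨hyT, by omega, hB y hyD hy1⟩, hyG⟩, rfl⟩

/-- In an irreducible tree a branch of diameter below `R` is small if the partial sums of `s` are at
least `z ^ 2 / 2` for `z < R`, but not for `z = R`. -/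
theorem Irreducible.card_branch_lt (hT : P.ParClosed T) (hs : Monotone s)
    (hI : P.Irreducible T s r) {R : ℕ} (hR : R ≤ r)
    (hS : ∀ z < R, (z : ℝ) ^ 2 / 2 ≤ partialSum s z) (hSR : partialSum s R < (R : ℝ) ^ 2 / 2)
    (hv : v ∈ T)
    (hd : ∀ x ∈ T, P.meetDepth v w ≤ P.meetDepth v x → P.tdist w x ≤ P.tdist v w)
    (hdiam : ∀ x ∈ T, P.meetDepth v w < P.dep x → P.diam T x < R)
    (hvw : P.meetDepth v w < P.dep v) :
    (P.branch T v (P.meetDepth v w)).card < R ∧ 2 * (P.hang T v (P.meetDepth v w)).card ≤ R := by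
  set k := P.meetDepth v w with hk
  have hc : P.anc v (k + 1) ∈ T := hT.anc hv _
  have hδ := hdiam _ hc (by rw [P.dep_anc (by omega)]; omega)
  have h1 := hI.card_below_le (hδ.trans_le hR)
  have h2 := card_hang_le (k := k) hT hv
  rw [← branch_eq_below hvw] at h1
  have h3 : P.diam T (P.anc v (k + 1)) ≤ 2 * (P.dep v - k) := by
    obtain ⟨x, hx, y, hy, hxy⟩ := exists_tdist_eq_diam (P := P) hc
    rw [← branch_eq_below hvw, mem_branch] at hx hy
    have hle : ∀ x, x ∈ T ∧ k < P.meetDepth v x → P.dep x ≤ P.dep v := by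
      rintro x ⟨hxT, hx⟩
      have e1 := hd x hxT hx.le
      have e2 := P.tdist_add w x
      have e3 := P.tdist_add v w
      have e4 := P.min_meetDepth_le v x w
      have e5 := P.meetDepth_comm x w
      omega
    have e1 := hle x hx
    have e2 := hle y hy
    have e3 := P.tdist_add x y
    have e4 := P.min_meetDepth_le x v y
    have e5 := P.meetDepth_comm x v
    omega
  set δ := P.diam T (P.anc v (k + 1))
  have h4 := partialSum.tangent_right hs hδ.le
  have h5 := hS δ hδ
  have h6 : (δ : ℝ) < R := by exact_mod_cast hδ
  have h7 : 2 * ((P.branch T v k).card : ℝ) < R + δ := by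
    refine lt_of_mul_lt_mul_left ?_ (sub_nonneg.2 h6.le)
    nlinarith [mul_le_mul_of_nonneg_left h1 (sub_nonneg.2 h6.le)]
  have h8 : 2 * (P.branch T v k).card < R + δ := by exact_mod_cast h7
  omega

/-- If covering sets of each diameter less than `R` costs less than `R ^ 2 / 2` in total, then a
tree of diameter at least `R` is not irreducible. -/
theorem Irreducible.sq_le (hT : P.ParClosed T) (hs : Monotone s) (hs0 : ∀ z, 0 ≤ s z)
    (hI : P.Irreducible T s r) {R : ℕ} (hR : R ≤ r) (hdiam : ∃ x ∈ T, R ≤ P.diam T x) :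
    (R : ℝ) ^ 2 / 2 ≤ partialSum s R := by
  classical
  induction R using Nat.strong_induction_on with
  | _ R ih =>
  by_contra! hSR
  obtain ⟨x₀, hx₀, hx₀R⟩ := hdiam
  have hS : ∀ z < R, (z : ℝ) ^ 2 / 2 ≤ partialSum s z := fun z hz =>
    ih z hz (by omega) ⟨x₀, hx₀, by omega⟩
  have hR0 : R ≠ 0 := by rintro rfl; simp at hSR
  -- a deepest subtree of diameter at least `R`
  obtain ⟨q, hq, hqmax⟩ := (T.filter fun x => R ≤ P.diam T x).exists_max_image P.dep
    ⟨x₀, mem_filter.2 ⟨hx₀, hx₀R⟩⟩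
  obtain ⟨hqT, hqR⟩ := mem_filter.1 hq
  obtain ⟨v, hv, w, hw, hvw⟩ := exists_tdist_eq_diam (P := P) hqT
  obtain ⟨hvT, hqv⟩ := mem_below.1 hv
  obtain ⟨hwT, hqw⟩ := mem_below.1 hw
  have hk : P.meetDepth v w = P.dep q := by
    have e1 := P.min_meetDepth_le v q w
    have e2 := P.meetDepth_comm v q
    have hmv := P.meetDepth_le_left v w
    have e3 := hqmax (P.anc v (P.meetDepth v w)) (mem_filter.2 ⟨hT.anc hvT _, by
      refine hqR.trans (hvw ▸ tdist_le_diam ?_ ?_)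
      · rw [mem_below_anc hmv, P.meetDepth_self]; exact ⟨hvT, hmv⟩
      · rw [mem_below_anc hmv]; exact ⟨hwT, le_rfl⟩⟩)
    rw [P.dep_anc hmv] at e3
    omega
  have hd : ∀ x ∈ T, P.meetDepth v w ≤ P.meetDepth v x →
      P.tdist v x ≤ P.tdist v w ∧ P.tdist w x ≤ P.tdist v w := by
    intro x hx hle
    have hxq : x ∈ P.below T q := by
      have e1 := P.min_meetDepth_le q v x
      have e2 := P.meetDepth_le_left q x
      exact mem_below.2 ⟨hx, by omega⟩
    exact ⟨hvw ▸ tdist_le_diam hv hxq, hvw ▸ tdist_le_diam hw hxq⟩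
  have hdiam : ∀ x ∈ T, P.meetDepth v w < P.dep x → P.diam T x < R := by
    intro x hx hlt
    by_contra! hge
    have := hqmax x (mem_filter.2 ⟨hx, hge⟩)
    omega
  have hwv : P.meetDepth w v = P.meetDepth v w := P.meetDepth_comm w v
  have hwv' : P.tdist w v = P.tdist v w := P.tdist_comm w v
  have hd' : ∀ x ∈ T, P.meetDepth w v ≤ P.meetDepth w x →
      P.tdist w x ≤ P.tdist w v ∧ P.tdist v x ≤ P.tdist w v := by
    intro x hx hle
    have e1 := P.min_meetDepth_le v w x
    rw [hwv']
    exact (hd x hx (by omega)).symm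
  have hadd := P.tdist_add v w
  have hml := P.meetDepth_le_left v w
  have hmr := P.meetDepth_le_right v w
  have hv1 := card_hang_le (k := P.meetDepth v w) hT hvT
  have hw1 := card_hang_le (k := P.meetDepth v w) hT hwT
  have hv2 := hI.card_branch_lt hT hs hR hS hSR hvT (fun x hx h => (hd x hx h).2) hdiam
  have hw2 := hI.card_branch_lt (v := w) (w := v) hT hs hR hS hSR hwT
    (fun x hx h => (hd' x hx h).2) (by rwa [hwv])
  rw [hwv] at hw2
  set k := P.meetDepth v w with hk'
  -- `q` is neither end of the diametral path: the other end would be too far away from it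
  have hkv : k < P.dep v := by by_contra! h; have := hw2 (by omega); omega
  have hkw : k < P.dep w := by by_contra! h; have := hv2 (by omega); omega
  obtain ⟨hv2, hv3⟩ := hv2 hkv
  obtain ⟨hw2, hw3⟩ := hw2 hkw
  set X := P.hang T v k ∪ P.hang T w k with hX
  have hXcard : X.card = (P.hang T v k).card + (P.hang T w k).card := by
    refine card_union_of_disjoint (disjoint_left.2 fun x hx hx' => ?_)
    have e1 := (mem_hang.1 hx).2.1
    have e2 := (mem_hang.1 hx').2.1
    have e3 := P.min_meetDepth_le v x w
    have e4 := P.meetDepth_comm x w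
    omega
  have hXsum : ∑ x ∈ X, s (P.diam T x) ≤
      partialSum s (P.hang T v k).card + partialSum s (P.hang T w k).card := by
    have e1 := sum_diam_le hT hs (DownClosed.hang (P := P) (T := T) (v := v) (k := k))
    have e2 := sum_diam_le hT hs (DownClosed.hang (P := P) (T := T) (v := w) (k := k))
    have e3 := sum_union_inter (s₁ := P.hang T v k) (s₂ := P.hang T w k)
      (f := fun x => s (P.diam T x))
    have e4 : 0 ≤ ∑ x ∈ P.hang T v k ∩ P.hang T w k, s (P.diam T x) :=
      sum_nonneg fun _ _ => hs0 _
    linarith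
  have hXsum' : ∑ x ∈ X, s (P.diam T x) ≤
      partialSum s ((P.hang T v k).card + (P.hang T w k).card) :=
    hXcard ▸ sum_diam_le hT hs (DownClosed.union .hang .hang)
  obtain ⟨g, hg⟩ := Nat.exists_eq_add_of_le (hvw.symm ▸ hqR : R ≤ P.tdist v w)
  refine partialSum.not_lt_sq hs (g := g) (α := P.cost T s X v) (β := P.cost T s X w) hSR
    (hS g (by omega)) hv3 hw3 (by omega) (fun I => (sum_cost_le hs0 I).trans hXsum)
    (fun I => (sum_cost_le hs0 I).trans hXsum') (fun I => (sum_cost_le hs0 I).trans hXsum)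
    (fun I => (sum_cost_le hs0 I).trans hXsum') ?_ ?_
  · intro z hz hzR
    have h := hI.card_branch_add_card_branch_le hT hd
      (fun x hx h => (hdiam x hx h).trans_le hR) (by rw [← hk']; omega) (z := z) (by omega)
      (by omega) (by omega)
    rw [hg] at h
    refine le_trans ?_ h
    have : R + g + ((P.hang T v k).card + (P.hang T w k).card) ≤
      (P.branch T v k).card + (P.branch T w k).card := by omega
    exact_mod_cast this
  · intro z hz
    refine ⟨hI.succ_le_add_cost hT hs0 hvT hd (fun x hx h => (hdiam x hx h).trans_le hR)
      (by rw [← hk']; omega) subset_union_left (by omega) (by omega), ?_⟩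
    refine hI.succ_le_add_cost (w := v) hT hs0 hwT hd'
      (fun x hx h => (hdiam x hx (by omega)).trans_le hR) ?_ ?_ (by omega) (by omega)
    · rw [hwv]; omega
    · rw [hwv]; exact subset_union_right

end ParentTree

/-! ### The multiplicative weights method -/

section

open Finset

/-- The least weight of a class `j ≤ n` whose radius `j * m` suffices for sets of diameter `z`. -/
noncomputable def price (w : ℕ → ℝ) (m n z : ℕ) : ℝ :=
  (Icc (min (z / (2 * m) + 1) n) n).inf' (nonempty_Icc.2 (min_le_right _ _)) w

theorem price_mono (w : ℕ → ℝ) (m n : ℕ) : Monotone (price w m n) := fun z z' h => by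
  refine inf'_mono _ (Icc_subset_Icc_left ?_) _
  have := Nat.div_le_div_right (c := 2 * m) h
  omega

theorem price_nonneg {w : ℕ → ℝ} (hw : ∀ j, 0 ≤ w j) (m n z : ℕ) : 0 ≤ price w m n z :=
  le_inf' _ _ fun j _ => hw j

theorem price_le {w : ℕ → ℝ} {m n z : ℕ} (hz : z / (2 * m) < n) :
    price w m n z ≤ w (z / (2 * m) + 1) :=
  inf'_le _ (mem_Icc.2 ⟨by omega, by omega⟩)

theorem exists_price_eq {w : ℕ → ℝ} {m n z : ℕ} (hm : 0 < m) (hz : z < n * (2 * m)) :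
    ∃ j, j ≤ n ∧ (z + 1) / 2 ≤ j * m ∧ price w m n z = w j := by
  obtain ⟨j, hj, h⟩ := exists_mem_eq_inf' (nonempty_Icc.2 (min_le_right (z / (2 * m) + 1) n)) w
  obtain ⟨h1, h2⟩ := mem_Icc.1 hj
  have h3 : z / (2 * m) < n := (Nat.div_lt_iff_lt_mul (by omega)).2 hz
  have h4 : z / (2 * m) < j := by omega
  rw [Nat.div_lt_iff_lt_mul (by omega)] at h4
  have h5 : j * (2 * m) = 2 * (j * m) := by ring
  exact ⟨j, h2, by omega, h⟩

theorem sum_range_mul_div (f : ℕ → ℝ) {q : ℕ} (hq : 0 < q) (n : ℕ) :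
    ∑ z ∈ range (n * q), f (z / q) = q * ∑ j ∈ range n, f j := by
  induction n with
  | zero => simp
  | succ n ih =>
    have : ∀ x ∈ range q, f ((n * q + x) / q) = f n := fun x hx => by
      rw [add_comm, Nat.add_mul_div_right _ _ hq, Nat.div_eq_of_lt (mem_range.1 hx), zero_add]
    rw [Nat.succ_mul, sum_range_add, ih, sum_range_succ, sum_congr rfl this]
    simp
    ring

theorem partialSum_price_le {w : ℕ → ℝ} {m n : ℕ} (hm : 0 < m) :
    partialSum (price w m n) (n * (2 * m)) ≤ 2 * m * ∑ j ∈ range n, w (j + 1) := by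
  have h := sum_range_mul_div (fun j => w (j + 1)) (show 0 < 2 * m by omega) n
  push_cast at h
  rw [← h]
  exact sum_le_sum fun z hz => price_le ((Nat.div_lt_iff_lt_mul (by omega)).2 (mem_range.1 hz))

theorem pow_le_one_add_mul {a : ℝ} (ha : 1 ≤ a) {k B : ℕ} (hk : k ≤ B) :
    a ^ k ≤ 1 + k * ((a - 1) * a ^ B) := by
  induction k with
  | zero => simp
  | succ k ih =>
    have h1 := ih (by omega)
    have h2 : a ^ k ≤ a ^ B := pow_le_pow_right₀ ha (by omega)
    rw [pow_succ]
    push_cast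
    nlinarith [mul_le_mul_of_nonneg_left h2 (sub_nonneg.2 ha)]

/-- The potential `∑ j ≤ n, a ^ u j`, where `u j` counts the balls of class `j` already used. -/
noncomputable def potential (a : ℝ) (n : ℕ) (u : ℕ → ℕ) : ℝ := ∑ j ∈ range (n + 1), a ^ u j

theorem one_le_potential {a : ℝ} (ha : 1 ≤ a) (n : ℕ) (u : ℕ → ℕ) : 1 ≤ potential a n u :=
  (one_le_pow₀ ha).trans (single_le_sum (f := fun j => a ^ u j)
    (fun _ _ => by positivity) (mem_range.2 (Nat.succ_pos n)))

/-- Using balls of classes `C` increases the potential by at most `(a - 1) * a ^ B` times their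
weights, if there are at most `B` of them. -/
theorem potential_add_count_le {a : ℝ} (ha : 1 ≤ a) {n B : ℕ} (u : ℕ → ℕ) {C : Multiset ℕ}
    (hC : C.card ≤ B) (hCn : ∀ j ∈ C, j ≤ n) :
    potential a n (fun j => u j + C.count j) ≤
      potential a n u + (a - 1) * a ^ B * (C.map fun j => a ^ u j).sum := by
  have h : (C.map fun j => a ^ u j).sum = ∑ j ∈ range (n + 1), C.count j * a ^ u j := by
    rw [sum_multiset_map_count]
    simp only [nsmul_eq_mul]
    refine sum_subset (fun j hj => ?_) fun j _ hj => ?_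
    · exact mem_range.2 (Nat.lt_succ_of_le (hCn j (Multiset.mem_toFinset.1 hj)))
    · rw [Multiset.count_eq_zero.2 fun h => hj (Multiset.mem_toFinset.2 h), Nat.cast_zero, zero_mul]
  rw [h, potential, potential, mul_sum, ← sum_add_distrib]
  refine sum_le_sum fun j _ => ?_
  have h1 := pow_le_one_add_mul ha ((C.count_le_card j).trans hC)
  rw [pow_add]
  nlinarith [mul_le_mul_of_nonneg_left h1 (show 0 ≤ a ^ u j by positivity)]

namespace ParentTree

variable {V : Type*} {P : ParentTree V} {T : Finset V}

theorem ParClosed.root_mem (hT : P.ParClosed T) {x : V} (hx : x ∈ T) : P.root ∈ T := by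
  rw [← P.anc_zero x]
  exact hT.anc hx 0

theorem below_root : P.below T P.root = T := by
  refine filter_true_of_mem fun x _ => ?_
  have := P.meetDepth_le_left P.root x
  rw [P.dep_root] at this ⊢
  omega

/-- One step of the multiplicative weights method: in a tree of large diameter there is a descending
part that balls of positive classes cover while the potential grows only in proportion to the number
of covered vertices. -/
theorem exists_cheap_cover (hT : P.ParClosed T) {m n B : ℕ} (hm : 0 < m) (hn : 0 < n) {a : ℝ}
    (ha : 1 ≤ a) (u : ℕ → ℕ) (hB : 4 * potential a n u ≤ B) {x₀ : V} (hx₀ : x₀ ∈ T)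
    (hdiam : n * (2 * m) ≤ P.diam T x₀) :
    ∃ D, P.DownClosed T D ∧ D.Nonempty ∧ ∃ L : Multiset (V × ℕ), (∀ p ∈ L, p.2 ≤ n) ∧
      (∀ x ∈ D, ∃ p ∈ L, P.tdist p.1 x ≤ p.2 * m) ∧
      potential a n (fun j => u j + (L.map Prod.snd).count j) ≤
        potential a n u * (1 + (a - 1) * a ^ B * D.card / ((n : ℝ) ^ 2 * m)) := by
  have hΦ := one_le_potential ha n u
  have hm' : (0 : ℝ) < m := by exact_mod_cast hm
  have hn' : (1 : ℝ) ≤ n := by exact_mod_cast hn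
  set Φ := potential a n u with hΦdef
  set θ := Φ / ((n : ℝ) ^ 2 * m) with hθ
  have hθ0 : 0 < θ := by positivity
  have hθΦ : θ * ((n : ℝ) ^ 2 * m) = Φ := by rw [hθ]; field_simp
  set w : ℕ → ℝ := fun j => a ^ u j / θ with hw
  have hw0 : ∀ j, 0 ≤ w j := fun j => by positivity
  have hnot : ¬ P.Irreducible T (price w m n) (n * (2 * m)) := by
    intro hI
    have h1 := hI.sq_le hT (price_mono w m n) (price_nonneg hw0 m n) le_rfl ⟨x₀, hx₀, hdiam⟩
    have h2 := partialSum_price_le (w := w) (n := n) hm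
    have h3 : ∑ j ∈ range n, w (j + 1) < Φ / θ := by
      rw [hw, ← sum_div, div_lt_div_iff_of_pos_right hθ0, hΦdef, potential, sum_range_succ']
      have : 0 < a ^ u 0 := by positivity
      linarith
    have h4 : Φ / θ = (n : ℝ) ^ 2 * m := by rw [← hθΦ]; field_simp
    rw [h4] at h3
    push_cast at h1
    nlinarith
  simp only [Irreducible, not_forall, not_le] at hnot
  obtain ⟨D, hD, M, hM, hcov, hcard, hlt⟩ := hnot
  have hcen : ∀ K : Finset V × ℕ, ∃ p : V × ℕ, K ∈ M → p.2 ≤ n ∧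
      (∀ y ∈ K.1, P.tdist p.1 y ≤ p.2 * m) ∧ price w m n K.2 = w p.2 := by
    intro K
    by_cases hK : K ∈ M
    · obtain ⟨h1, h2⟩ := hM K hK
      obtain ⟨j, hj, hj', hjw⟩ := exists_price_eq (w := w) hm h1
      rcases K.1.eq_empty_or_nonempty with he | hne
      · exact ⟨(P.root, j), fun _ => ⟨hj, by simp [he], hjw⟩⟩
      · obtain ⟨c, hc⟩ := P.exists_center hne h2
        exact ⟨(c, j), fun _ => ⟨hj, fun y hy => (hc y hy).trans hj', hjw⟩⟩
    · exact ⟨(P.root, 0), fun h => absurd h hK⟩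
  choose f hf using hcen
  have hsum : (((M.map f).map Prod.snd).map fun j => a ^ u j).sum < θ * D.card := by
    have h1 : (M.map fun K => price w m n K.2).sum =
        (((M.map f).map Prod.snd).map fun j => a ^ u j).sum / θ := by
      rw [← Multiset.sum_map_div, Multiset.map_map, Multiset.map_map]
      exact congrArg _ (Multiset.map_congr rfl fun K hK => (hf K hK).2.2)
    rw [h1, div_lt_iff₀ hθ0] at hlt
    linarith
  have hcardB : ((M.map f).map Prod.snd).card ≤ B := by
    rcases hcard with h | h
    · rw [Multiset.card_map, Multiset.card_map, h]
      have : (1 : ℝ) ≤ B := by linarith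
      exact_mod_cast this
    · have h1 : (((M.map f).map Prod.snd).card : ℝ) ≤
          (((M.map f).map Prod.snd).map fun j => a ^ u j).sum := by
        have := Multiset.card_nsmul_le_sum
          (s := ((M.map f).map Prod.snd).map fun j => a ^ u j) (a := (1 : ℝ)) (by
            intro x hx
            obtain ⟨j, -, rfl⟩ := Multiset.mem_map.1 hx
            exact one_le_pow₀ ha)
        simpa using this
      have h2 : (D.card : ℝ) ≤ 2 * (n * (2 * m)) := by exact_mod_cast h
      have h3 : θ * D.card ≤ 4 * Φ := by
        calc θ * D.card ≤ θ * (2 * (n * (2 * m))) := by gcongr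
          _ ≤ 4 * (θ * ((n : ℝ) ^ 2 * m)) := by
            have : 0 ≤ θ * m * (n * (n - 1)) :=
              mul_nonneg (by positivity) (mul_nonneg (by linarith) (by linarith))
            nlinarith
          _ = 4 * Φ := by rw [hθΦ]
      have : (((M.map f).map Prod.snd).card : ℝ) ≤ B := by linarith
      exact_mod_cast this
  refine ⟨D, hD, ?_, M.map f, ?_, ?_, ?_⟩
  · rw [← card_pos]
    have h1 : 0 ≤ (M.map fun K => price w m n K.2).sum :=
      Multiset.sum_nonneg fun x hx => by
        obtain ⟨K, -, rfl⟩ := Multiset.mem_map.1 hx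
        exact price_nonneg hw0 m n _
    exact_mod_cast h1.trans_lt hlt
  · intro p hp
    obtain ⟨K, hK, rfl⟩ := Multiset.mem_map.1 hp
    exact (hf K hK).1
  · intro x hx
    obtain ⟨K, hK, hxK⟩ := hcov x hx
    exact ⟨f K, Multiset.mem_map_of_mem f hK, (hf K hK).2.1 x hxK⟩
  · refine (potential_add_count_le ha u hcardB ?_).trans ?_
    · intro j hj
      obtain ⟨p, hp, rfl⟩ := Multiset.mem_map.1 hj
      obtain ⟨K, hK, rfl⟩ := Multiset.mem_map.1 hp
      exact (hf K hK).1
    · have h1 : 0 ≤ (a - 1) * a ^ B := mul_nonneg (by linarith) (by positivity)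
      have h2 : Φ * (1 + (a - 1) * a ^ B * D.card / ((n : ℝ) ^ 2 * m)) =
          Φ + (a - 1) * a ^ B * (θ * D.card) := by rw [hθ]; ring
      rw [h2]
      gcongr

/-- The multiplicative weights method: the tree can be covered by one ball of radius `(n + 1) * m`
and balls of radii `j * m` with `j ≤ n`, whose numbers the potential bounds. -/
theorem exists_cover {m n B : ℕ} (hm : 0 < m) (hn : 0 < n) {a : ℝ} (ha : 1 ≤ a)
    (hT : P.ParClosed T) (u : ℕ → ℕ)
    (hB : 4 * (potential a n u * Real.exp ((a - 1) * a ^ B * T.card / ((n : ℝ) ^ 2 * m))) ≤ B) :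
    ∃ c, ∃ L : Multiset (V × ℕ), (∀ p ∈ L, p.2 ≤ n) ∧
      (∀ x ∈ T, (∃ p ∈ L, P.tdist p.1 x ≤ p.2 * m) ∨ P.tdist c x ≤ (n + 1) * m) ∧
      potential a n (fun j => u j + (L.map Prod.snd).count j) ≤
        potential a n u * Real.exp ((a - 1) * a ^ B * T.card / ((n : ℝ) ^ 2 * m)) := by
  classical
  have ha' : 0 ≤ (a - 1) * a ^ B := mul_nonneg (by linarith) (by positivity)
  induction hN : T.card using Nat.strong_induction_on generalizing T u with
  | _ N ih =>
  subst hN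
  have hΦ := one_le_potential ha n u
  have hexp : 1 ≤ Real.exp ((a - 1) * a ^ B * T.card / ((n : ℝ) ^ 2 * m)) :=
    Real.one_le_exp (by positivity)
  rcases T.eq_empty_or_nonempty with rfl | ⟨x₀, hx₀⟩
  · exact ⟨P.root, 0, by simp, by simp, by simp⟩
  have hroot := hT.root_mem hx₀
  by_cases hdiam : n * (2 * m) ≤ P.diam T P.root
  · obtain ⟨D, hD, hDne, L, hLn, hLcov, hL⟩ := exists_cheap_cover hT hm hn ha u
      ((mul_le_mul_of_nonneg_left (le_mul_of_one_le_right (by linarith) hexp)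
        (by norm_num)).trans hB) hroot hdiam
    have hcard : (T \ D).card + D.card = T.card := card_sdiff_add_card_eq_card hD.1
    have hpos := hDne.card_pos
    have hT' : P.ParClosed (T \ D) := fun x hx => by
      rw [mem_sdiff] at hx ⊢
      exact ⟨hT x hx.1, fun h => hx.2 (hD.2 x hx.1 h)⟩
    have hstep : potential a n (fun j => u j + (L.map Prod.snd).count j) *
        Real.exp ((a - 1) * a ^ B * (T \ D).card / ((n : ℝ) ^ 2 * m)) ≤
        potential a n u * Real.exp ((a - 1) * a ^ B * T.card / ((n : ℝ) ^ 2 * m)) := by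
      have h1 := Real.add_one_le_exp ((a - 1) * a ^ B * D.card / ((n : ℝ) ^ 2 * m))
      rw [← hcard]
      push_cast
      rw [mul_add, add_div, add_comm (_ / _), Real.exp_add, ← mul_assoc]
      gcongr
      refine hL.trans ?_
      gcongr
      linarith
    obtain ⟨c, L', hLn', hLcov', hL'⟩ := ih (T \ D).card (by omega) hT'
      (fun j => u j + (L.map Prod.snd).count j) (by linarith) rfl
    refine ⟨c, L + L', fun p hp => ?_, fun x hx => ?_, ?_⟩
    · rcases Multiset.mem_add.1 hp with h | h
      exacts [hLn p h, hLn' p h]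
    · by_cases hxD : x ∈ D
      · obtain ⟨p, hp, h⟩ := hLcov x hxD
        exact Or.inl ⟨p, Multiset.mem_add.2 (Or.inl hp), h⟩
      · refine (hLcov' x (mem_sdiff.2 ⟨hx, hxD⟩)).imp_left ?_
        rintro ⟨p, hp, h⟩
        exact ⟨p, Multiset.mem_add.2 (Or.inr hp), h⟩
    · refine le_trans (le_of_eq ?_) (hL'.trans hstep)
      congr 1
      funext j
      rw [Multiset.map_add, Multiset.count_add, add_assoc]
  · obtain ⟨c, hc⟩ := P.exists_center ⟨x₀, hx₀⟩ (z := P.diam T P.root) fun x hx y hy =>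
      tdist_le_diam (by rwa [below_root]) (by rwa [below_root])
    refine ⟨c, 0, by simp, fun x hx => Or.inr ((hc x hx).trans ?_), ?_⟩
    · have h1 : n * (2 * m) = 2 * (n * m) := by ring
      have h2 : (n + 1) * m = n * m + m := by ring
      omega
    · simpa using le_mul_of_one_le_right (by linarith) hexp

end ParentTree

end

/-! ### Burning -/

open Finset Filter Topology

/-- Balls of radii `j * m` with `j ≤ n`, at most `m` of each, and one of radius `(n + 1) * m` can be
replaced by balls of different radii: the `t`-th one of radius `j * m` gets radius `j * m + t`. -/
theorem SimpleGraph.canBurn_of_cover {V : Type*} {G : SimpleGraph V} {m n : ℕ} {c₀ : V}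
    {L : Multiset (V × ℕ)} (hLn : ∀ p ∈ L, p.2 ≤ n)
    (hcount : ∀ j ≤ n, (L.map Prod.snd).count j ≤ m)
    (hcov : ∀ x, (∃ p ∈ L, G.edist p.1 x ≤ (p.2 * m : ℕ)) ∨ G.edist c₀ x ≤ ((n + 1) * m : ℕ)) :
    G.CanBurn ((n + 1) * m + 1) := by
  classical
  let l : ℕ → List V := fun j => ((L.filter fun p => p.2 = j).map Prod.fst).toList
  have hl : ∀ j ≤ n, (l j).length ≤ m := by
    intro j hj
    have h := hcount j hj
    rw [Multiset.count_map] at h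
    simpa [l, eq_comm] using h
  -- radius `j * m + t` goes to the `t`-th entry of `l j`, if there is one
  refine ⟨fun i => if (i : ℕ) = (n + 1) * m then c₀ else (l (i / m)).getD (i % m) c₀, fun x => ?_⟩
  rcases hcov x with ⟨p, hp, hpx⟩ | h
  · have hpl : p.1 ∈ l p.2 := by
      simp only [l, Multiset.mem_toList, Multiset.mem_map, Multiset.mem_filter]
      exact ⟨p, ⟨hp, rfl⟩, rfl⟩
    obtain ⟨t, ht, htp⟩ := List.mem_iff_getElem.1 hpl
    have htm : t < m := ht.trans_le (hl _ (hLn p hp))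
    have hlt : p.2 * m + t < (n + 1) * m := by
      have := Nat.mul_le_mul_right m (hLn p hp)
      rw [Nat.succ_mul]
      omega
    refine ⟨⟨p.2 * m + t, by omega⟩, ?_⟩
    have h1 : (p.2 * m + t) / m = p.2 := by
      rw [add_comm, Nat.add_mul_div_right _ _ (by omega), Nat.div_eq_of_lt htm, zero_add]
    have h2 : (p.2 * m + t) % m = t := by
      rw [add_comm, Nat.add_mul_mod_self_right, Nat.mod_eq_of_lt htm]
    simp only [hlt.ne, if_false, h1, h2, List.getD_eq_getElem _ _ ht, htp]
    exact hpx.trans (by exact_mod_cast Nat.le_add_right _ _)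
  · exact ⟨⟨(n + 1) * m, by omega⟩, by simpa using h⟩

/-- A numerical condition under which `(n + 1) * m + 1` balls suffice. It forces the multiplicative
weights method with growth factor `a` to use each of the radii `j * m` at most `m` times: by `hlt`,
a further use would push the potential above its bound. -/
theorem SimpleGraph.Connected.canBurn {V : Type*} [Fintype V] {G : SimpleGraph V}
    (hG : G.Connected) {m n B : ℕ} (hm : 0 < m) (hn : 0 < n) {a E : ℝ} (ha : 1 < a)
    (hE : (a - 1) * a ^ B * Fintype.card V / ((n : ℝ) ^ 2 * m) ≤ E)
    (hB : 4 * ((n + 1) * Real.exp E) ≤ B) (hlt : (n + 1) * Real.exp E < a ^ (m + 1)) :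
    G.CanBurn ((n + 1) * m + 1) := by
  obtain ⟨P, hP⟩ := hG.exists_parentTree
  have h0 : potential a n (fun _ => 0) = n + 1 := by simp [potential]
  have hexp : potential a n (fun _ => 0) *
      Real.exp ((a - 1) * a ^ B * (univ : Finset V).card / ((n : ℝ) ^ 2 * m)) ≤
        (n + 1) * Real.exp E := by
    rw [h0, card_univ]
    gcongr
  obtain ⟨c, L, hLn, hcov, hL⟩ := P.exists_cover (T := univ) (B := B) hm hn ha.le
    (fun x _ => mem_univ _) (fun _ => 0) (by linarith)
  refine canBurn_of_cover (c₀ := c) hLn (fun j hj => ?_) fun x => ?_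
  · have h1 : a ^ (L.map Prod.snd).count j ≤
        potential a n (fun j => 0 + (L.map Prod.snd).count j) := by
      have := single_le_sum (f := fun j => a ^ (0 + (L.map Prod.snd).count j))
        (fun _ _ => by positivity) (mem_range.2 (Nat.lt_succ_of_le hj))
      simpa only [zero_add, potential] using this
    have h2 := (pow_lt_pow_iff_right₀ ha).1 (h1.trans_lt ((hL.trans hexp).trans_lt hlt))
    omega
  · refine (hcov x (mem_univ x)).imp ?_ fun h => ?_
    · rintro ⟨p, hp, h⟩
      exact ⟨p, hp, (P.edist_le_tdist hP _ _).trans (by exact_mod_cast h)⟩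
    · exact (P.edist_le_tdist hP _ _).trans (by exact_mod_cast h)

theorem theorem1 :
    ∀ ε : ℝ, 0 < ε → ∃ N : ℕ, ∀ (V : Type*) [Fintype V] (G : SimpleGraph V),
      G.Connected → N ≤ Fintype.card V →
        (G.burningNumber : ℝ) ≤ (1 + ε) * Real.sqrt (Fintype.card V : ℝ) := by
  intro ε hε
  set κ : ℝ := 1 + ε / 2 with hκ
  have hκ1 : 1 < κ := by linarith
  -- the number of classes: `(n + 1) / n < κ`
  obtain ⟨n, hn⟩ := exists_nat_gt (1 / (κ - 1))
  have hn0 : (0 : ℝ) < n := lt_trans (by have := sub_pos.2 hκ1; positivity) hn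
  have hnκ : (n : ℝ) + 1 < κ * n := by
    rw [div_lt_iff₀ (sub_pos.2 hκ1)] at hn
    linarith
  set q : ℝ := ((n + 1) / (κ * n)) ^ 2 with hq
  have hκn : 0 < κ * n := by positivity
  have hq1 : q < 1 := by
    rw [hq, sq_lt_one_iff₀ (by positivity), div_lt_one hκn]
    exact hnκ
  -- the growth factor `1 + η / m`, for which `exp (q * η)` and `exp η` differ enough
  obtain ⟨η, hη⟩ := exists_gt (max 0 (Real.log (n + 1) / (1 - q)))
  have hη0 : 0 < η := (le_max_left _ _).trans_lt hη
  have hηlog : (n + 1) * Real.exp (q * η) < Real.exp η := by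
    have h1 := (le_max_right _ _).trans_lt hη
    rw [div_lt_iff₀ (sub_pos.2 hq1)] at h1
    calc (n + 1) * Real.exp (q * η) = Real.exp (Real.log (n + 1) + q * η) := by
          rw [Real.exp_add, Real.exp_log (by positivity)]
      _ < Real.exp η := Real.exp_lt_exp.2 (by linarith)
  -- as `E ≤ η` below, `B` does not depend on `m`
  obtain ⟨B, hB⟩ := exists_nat_ge (4 * ((n + 1) * Real.exp η))
  have hlim1 : Tendsto (fun m : ℕ => 1 + η / (m : ℝ)) atTop (𝓝 1) := by
    simpa using tendsto_const_nhds.add (tendsto_const_div_atTop_nhds_zero_nat η)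
  have hlim2 : Tendsto (fun m : ℕ => q * η * (1 + η / (m : ℝ)) ^ B) atTop (𝓝 (q * η)) := by
    simpa using (hlim1.pow B).const_mul (q * η)
  have hlim3 : Tendsto (fun m : ℕ => (n + 1) * Real.exp (q * η * (1 + η / (m : ℝ)) ^ B)) atTop
      (𝓝 ((n + 1) * Real.exp (q * η))) :=
    ((Real.continuous_exp.tendsto _).comp hlim2).const_mul _
  have hev := (hlim3.eventually_lt (Real.tendsto_one_add_div_pow_exp η) hηlog).and
    ((hlim2.eventually_lt_const (show q * η < η by nlinarith)).and (eventually_gt_atTop 0))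
  obtain ⟨m₀, hm₀⟩ := eventually_atTop.1 hev
  obtain ⟨N, hN⟩ := exists_nat_ge (max (((n + 1) * m₀ : ℝ) ^ 2) ((2 * (n + 2) / ε) ^ 2))
  refine ⟨N, fun V _ G hG hV => ?_⟩
  set r := Real.sqrt (Fintype.card V : ℝ) with hr
  have hV' : (N : ℝ) ≤ Fintype.card V := by exact_mod_cast hV
  have hr1 : (n + 1) * m₀ ≤ r :=
    Real.le_sqrt_of_sq_le (((le_max_left _ _).trans hN).trans hV')
  have hr2 : 2 * (n + 2) / ε ≤ r :=
    Real.le_sqrt_of_sq_le (((le_max_right _ _).trans hN).trans hV')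
  have hrsq : r ^ 2 = Fintype.card V := Real.sq_sqrt (Nat.cast_nonneg _)
  have hr0 : 0 ≤ r := Real.sqrt_nonneg _
  set m := ⌈κ * r / (n + 1)⌉₊ with hm
  have hmr : κ * r ≤ (n + 1) * m := by
    have := Nat.le_ceil (κ * r / (n + 1))
    rw [div_le_iff₀ (by positivity)] at this
    linarith
  have hmr' : (n + 1) * (m : ℝ) ≤ κ * r + (n + 1) := by
    have h1 := (Nat.ceil_lt_add_one (show 0 ≤ κ * r / (n + 1) by positivity)).le
    rw [← hm, ← sub_le_iff_le_add, le_div_iff₀ (by positivity)] at h1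
    linarith
  have hmm₀ : m₀ ≤ m := by
    have : (m₀ : ℝ) ≤ m := le_of_mul_le_mul_left
      ((hr1.trans (by nlinarith)).trans hmr) (show (0 : ℝ) < n + 1 by positivity)
    exact_mod_cast this
  obtain ⟨hm1, hm2, hm3⟩ := hm₀ m hmm₀
  have hm0 : (0 : ℝ) < m := by exact_mod_cast hm3
  have ha : 1 < 1 + η / (m : ℝ) := lt_add_of_pos_right 1 (div_pos hη0 hm0)
  have hburn : G.CanBurn ((n + 1) * m + 1) := by
    refine hG.canBurn (B := B) hm3 (by exact_mod_cast hn0) ha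
      (E := q * η * (1 + η / (m : ℝ)) ^ B) ?_ ?_ ?_
    · have h1 : (Fintype.card V : ℝ) ≤ ((n + 1) * m / κ) ^ 2 := by
        rw [← hrsq]
        gcongr
        rw [le_div_iff₀ (by linarith)]
        linarith
      calc _ ≤ (1 + η / (m : ℝ) - 1) * (1 + η / (m : ℝ)) ^ B * ((n + 1) * m / κ) ^ 2 /
            ((n : ℝ) ^ 2 * m) := by
            gcongr
        _ = _ := by
            rw [hq]
            field_simp
            ring
    · refine le_trans ?_ hB
      gcongr
    · refine hm1.trans_le (pow_le_pow_right₀ ha.le (Nat.le_succ m))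
  have hle : (G.burningNumber : ℝ) ≤ (n + 1) * m + 1 := by
    exact_mod_cast (Nat.sInf_le hburn : G.burningNumber ≤ (n + 1) * m + 1)
  have h3 : (n : ℝ) + 2 ≤ ε / 2 * r := by
    rw [div_le_iff₀ hε] at hr2
    linarith
  calc (G.burningNumber : ℝ) ≤ κ * r + (n + 2) := by linarith
    _ ≤ κ * r + ε / 2 * r := by linarith
    _ = (1 + ε) * r := by rw [hκ]; ring
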